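/- A matching instance $I=(P,Q,E,\succ)$ consists of finite sets $P$ of firms and $Q$ of workers, a set $E\subseteq P\times Q$ of acceptable pairs, and for each agent $r\in P\cup Q$ a strict linear preference $\succ_r$ over its acceptable partners; being unmatched is the bottom of every preference. A matching is a set of pairs in $E$ in which every agent occurs at most once. A matching $\mu$ is stable if no $(p,q)\in E$ satisfies both $q\succ_p\mu(p)$ and $p\succ_q\mu(q)$. The worker-optimal stable matching $\mathrm{QOPT}(I)$ is the stable matching that every worker weakly prefers to every stable matching. An offering order is a linear order $\sigma$ on $E$ in which each firm's pairs appear in the order of that firm's preference; $\sigma$ is position-based if there is a linear order of the firms such that all pairs of an earlier firm precede all pairs of a later firm. In the sequential matching game $(I,\sigma)$, the first pair $(p,q)$ of $\sigma$ is an offer from $p$ to $q$. If $q$ accepts, then $p$ and $q$ are matched irrevocably and all pairs containing $p$ or $q$ are removed; if $q$ rejects, only $(p,q)$ is removed. The game continues in the same way with the remaining pairs, in the order of $\sigma$, until none is left. Each worker (with perfect information) cares only about her own assignment. A subgame perfect equilibrium (SPE) is a strategy profile of the workers that is a Nash equilibrium of every subgame. All SPEs of $(I,\sigma)$ have the same outcome,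 which is called the SPE matching $\mathrm{SPE}(I,\sigma)$. **Corollary.** Every matching instance $I$ has exactly one worker-optimal stable matching $\mathrm{QOPT}(I)$. If for every pair $(p,q)\in\mathrm{QOPT}(I)$ the worker $q$ is the most preferred worker on the list of the firm $p$, then there is a position-based offering order $\sigma$ such that an SPE of $(I,\sigma)$ exists and every SPE of $(I,\sigma)$ has the outcome $\mathrm{QOPT}(I)$; that is, $\mathrm{SPE}(I,\sigma)=\mathrm{QOPT}(I)$. -/

import Mathlib

/-- A matching instance with firms `P` and workers `Q`: a set `E` of acceptable pairs and, for every
agent, a strict linear preference over its acceptable partners. `firmPref p q q'` reads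
`q ≻_p q'`, and `workerPref q p p'` reads `p ≻_q p'`; their values on unacceptable partners are
irrelevant and unconstrained. -/
structure MatchingInstance (P Q : Type*) where
  E : Finset (P × Q)
  firmPref : P → Q → Q → Prop
  workerPref : Q → P → P → Prop
  firm_irrefl : ∀ p q, (p, q) ∈ E → ¬ firmPref p q q
  firm_trans : ∀ p q₁ q₂ q₃, (p, q₁) ∈ E → (p, q₂) ∈ E → (p, q₃) ∈ E →
    firmPref p q₁ q₂ → firmPref p q₂ q₃ → firmPref p q₁ q₃
  firm_total : ∀ p q₁ q₂, (p, q₁) ∈ E → (p, q₂) ∈ E → q₁ ≠ q₂ →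
    firmPref p q₁ q₂ ∨ firmPref p q₂ q₁
  worker_irrefl : ∀ q p, (p, q) ∈ E → ¬ workerPref q p p
  worker_trans : ∀ q p₁ p₂ p₃, (p₁, q) ∈ E → (p₂, q) ∈ E → (p₃, q) ∈ E →
    workerPref q p₁ p₂ → workerPref q p₂ p₃ → workerPref q p₁ p₃
  worker_total : ∀ q p₁ p₂, (p₁, q) ∈ E → (p₂, q) ∈ E → p₁ ≠ p₂ →
    workerPref q p₁ p₂ ∨ workerPref q p₂ p₁

/-- The two possible answers of a worker to an offer. -/
inductive OfferAction : Type
  | accept : OfferAction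
  | reject : OfferAction

/-- A strategy profile of a sequential matching game gives an action at every decision node. Nodes
are named by their histories (the list of past actions, first action first); the strategy of one
worker is the restriction of the profile to the nodes at which she receives the offer. -/
abbrev StrategyProfile : Type := List OfferAction → OfferAction

namespace MatchingInstance

variable {P Q : Type*}

/-- A matching, as a set of acceptable pairs in which every agent occurs at most once. -/
def IsMatching (I : MatchingInstance P Q) (μ : Finset (P × Q)) : Prop :=
  μ ⊆ I.E ∧
  (∀ p q q', (p, q) ∈ μ → (p, q') ∈ μ → q = q') ∧
  (∀ q p p', (p, q) ∈ μ → (p', q) ∈ μ → p = p')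

/-- `μ ≻_q ν`: worker `q` is matched in `μ`, and in `ν` she is unmatched or matched with a firm she
likes less. -/
def WorkerPrefers (I : MatchingInstance P Q) (q : Q) (μ ν : Finset (P × Q)) : Prop :=
  ∃ p, (p, q) ∈ μ ∧ ∀ p', (p', q) ∈ ν → I.workerPref q p p'

/-- `μ ⪰_q ν`: worker `q` has the same assignment in `μ` and `ν`, or prefers `μ`. -/
def WorkerWeaklyPrefers (I : MatchingInstance P Q) (q : Q) (μ ν : Finset (P × Q)) : Prop :=
  I.WorkerPrefers q μ ν ∨ ∀ p, (p, q) ∈ μ ↔ (p, q) ∈ ν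

/-- `(p, q)` is an acceptable pair with `q ≻_p μ(p)` and `p ≻_q μ(q)`, where being unmatched is the
bottom of every preference. -/
def Blocks (I : MatchingInstance P Q) (μ : Finset (P × Q)) (p : P) (q : Q) : Prop :=
  (p, q) ∈ I.E ∧
  (∀ q', (p, q') ∈ μ → I.firmPref p q q') ∧
  (∀ p', (p', q) ∈ μ → I.workerPref q p p')

def IsStable (I : MatchingInstance P Q) (μ : Finset (P × Q)) : Prop :=
  I.IsMatching μ ∧ ∀ p q, ¬ I.Blocks μ p q

/-- `μ` is the worker-optimal stable matching. -/
def IsWorkerOptimalStable (I : MatchingInstance P Q) (μ : Finset (P × Q)) : Prop :=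
  I.IsStable μ ∧ ∀ ν, I.IsStable ν → ∀ q, I.WorkerWeaklyPrefers q μ ν

/-- Worker `q` is on the top of the preference list of firm `p`. -/
def IsTopOf (I : MatchingInstance P Q) (p : P) (q : Q) : Prop :=
  (p, q) ∈ I.E ∧ ∀ q', (p, q') ∈ I.E → q' ≠ q → I.firmPref p q q'

variable [DecidableEq P] [DecidableEq Q]

/-- `σ` lists every acceptable pair exactly once (so it is a linear order on `E`, in which the rank
of `e` is `σ.idxOf e`), and every firm makes its offers in the order of its preference. -/
def IsOfferingOrder (I : MatchingInstance P Q) (σ : List (P × Q)) : Prop :=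
  σ.Nodup ∧ (∀ e, e ∈ σ ↔ e ∈ I.E) ∧
  ∀ p q q', (p, q) ∈ I.E → (p, q') ∈ I.E → I.firmPref p q q' →
    σ.idxOf (p, q) < σ.idxOf (p, q')

/-- `σ` is induced by some linear order `π` of the firms: all offers of an earlier firm precede all
offers of a later firm. -/
def IsPositionBased [Fintype P] (I : MatchingInstance P Q) (σ : List (P × Q)) : Prop :=
  ∃ π : Fin (Fintype.card P) ≃ P, ∀ p p', π.symm p < π.symm p' →
    ∀ q q', (p, q) ∈ I.E → (p', q') ∈ I.E → σ.idxOf (p, q) < σ.idxOf (p', q')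

/-- The offers left after the pair `e` has been matched: those involving neither of its members. -/
def contractOffers (e : P × Q) (σ : List (P × Q)) : List (P × Q) :=
  σ.filter (fun f => decide (f.1 ≠ e.1 ∧ f.2 ≠ e.2))

/-- The offers left at the node with the given history; the subgame at that node is the sequential
matching game on these offers, in this order. The first of them is the current offer. If it is
accepted, the firm and the worker leave the market; if it is rejected, only this offer is deleted.
Nodes at which no offer is left are terminal. -/
def offersAfter : List (P × Q) → List OfferAction → List (P × Q)
  | σ, [] => σ
  | [], _ :: _ => []
  | e :: σ, OfferAction.accept :: h => offersAfter (contractOffers e σ) h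
  | _ :: σ, OfferAction.reject :: h => offersAfter σ h

/-- The outcome (set of matched pairs) of the game on the offers `σ` when it is played according to
the profile `s`. -/
def outcome : List (P × Q) → StrategyProfile → Finset (P × Q)
  | [], _ => ∅
  | e :: σ, s =>
    match s [] with
    | OfferAction.accept =>
        insert e (outcome (contractOffers e σ) (fun h => s (OfferAction.accept :: h)))
    | OfferAction.reject => outcome σ (fun h => s (OfferAction.reject :: h))
termination_by σ => σ.length
decreasing_by
  · exact Nat.lt_succ_of_le (List.length_filter_le _ _)
  · exact Nat.lt_succ_self _

/-- `s` is a Nash equilibrium of the game on the offers `σ`: no worker `q` can obtain a better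
assignment by changing the actions at the nodes where she is the one to receive the offer. -/
def IsNash (I : MatchingInstance P Q) (σ : List (P × Q)) (s : StrategyProfile) : Prop :=
  ∀ (q : Q) (s' : StrategyProfile),
    (∀ h e, (offersAfter σ h).head? = some e → e.2 ≠ q → s' h = s h) →
    ¬ I.WorkerPrefers q (outcome σ s') (outcome σ s)

/-- `s` is a subgame perfect equilibrium: after every history, its continuation is a Nash
equilibrium of the subgame reached. -/
def IsSPE (I : MatchingInstance P Q) (σ : List (P × Q)) (s : StrategyProfile) : Prop :=
  ∀ h : List OfferAction, I.IsNash (offersAfter σ h) (fun h' => s (h ++ h'))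

/-- `μ` is the outcome of some subgame perfect equilibrium of the game with offering order `σ`. -/
def IsSPEMatching (I : MatchingInstance P Q) (σ : List (P × Q)) (μ : Finset (P × Q)) : Prop :=
  ∃ s : StrategyProfile, I.IsSPE σ s ∧ outcome σ s = μ

end MatchingInstance

namespace MatchingInstance

/-! Worker-optimality forbids rotations. Call `q` a candidate of `p` if she would leave her partner
in `μ` for `p`, and point `p` to the firm that employs its best candidate in `μ`. Moving every firm
on a cycle of this relation to its best candidate would give a stable matching better for the
workers involved (`IsWorkerOptimalStable.no_rotation`). So the relation is acyclic, and the firms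
can be ordered with each firm before the one it points to.

Play the offers in this firm order. Backward induction gives the unique equilibrium outcome `speOut`
(`isSPEMatching_iff`). If each firm matched in `μ` is paired with its top worker, its offer to her
comes first, so she can wait for it and never does worse than in `μ` (`speOut_guarantee`). Let `F`
be the firms holding an equilibrium pair outside `μ`. Stability of `μ` gives each of them a partner
in `μ`, whose equilibrium employer is again in `F`; this map permutes `F`, so every worker who
changes partner has her `μ`-firm in `F`.

If `F` is nonempty, some `p₀` in it points to no firm of `F`, so its best candidate `q₀` keeps her
`μ`-partner, or stays unmatched. But `p₀` offers to `q₀` before its equilibrium partner and before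
the `μ`-firm of `q₀` makes any offer, and `q₀` would gain by accepting. Hence `F` is empty, and the
guarantee gives equality with `μ`. -/

theorem exists_best_of_total {α : Type*} [DecidableEq α] (r : α → α → Prop) (s : Finset α)
    (hne : s.Nonempty)
    (ht : ∀ a ∈ s, ∀ b ∈ s, ∀ c ∈ s, r a b → r b c → r a c)
    (htot : ∀ a ∈ s, ∀ b ∈ s, a ≠ b → r a b ∨ r b a) :
    ∃ a ∈ s, ∀ b ∈ s, b ≠ a → r a b := by
  induction hne using Finset.Nonempty.cons_induction with
  | singleton a => exact ⟨a, by simp, by simp +contextual⟩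
  | cons a s ha hs ih =>
    obtain ⟨m, hm, hbest⟩ := ih
      (fun x hx y hy z hz => ht x (by simp [hx]) y (by simp [hy]) z (by simp [hz]))
      (fun x hx y hy => htot x (by simp [hx]) y (by simp [hy]))
    have ham : a ≠ m := fun h => ha (h ▸ hm)
    rcases htot a (by simp) m (by simp [hm]) ham with h | h
    · refine ⟨a, by simp, fun b hb hba => ?_⟩
      have hbs : b ∈ s := by simpa [hba] using hb
      by_cases hbm : b = m
      · exact hbm ▸ h
      · exact ht a (by simp) m (by simp [hm]) b hb h (hbest b hbs hbm)
    · refine ⟨m, by simp [hm], fun b hb hbm => ?_⟩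
      by_cases hba : b = a
      · exact hba ▸ h
      · exact hbest b (by simpa [hba] using hb) hbm

/-! ### Best partners and uniqueness of the worker-optimal stable matching -/

section Preferences

variable {P Q : Type*} (I : MatchingInstance P Q)

theorem firm_asymm {p : P} {q q' : Q} (h : (p, q) ∈ I.E) (h' : (p, q') ∈ I.E)
    (hr : I.firmPref p q q') : ¬ I.firmPref p q' q := fun hr' =>
  I.firm_irrefl p q h (I.firm_trans p q q' q h h' h hr hr')

theorem worker_asymm {p p' : P} {q : Q} (h : (p, q) ∈ I.E) (h' : (p', q) ∈ I.E)
    (hr : I.workerPref q p p') : ¬ I.workerPref q p' p := fun hr' =>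
  I.worker_irrefl q p h (I.worker_trans q p p' p h h' h hr hr')

theorem exists_best_worker [DecidableEq Q] (p : P) (s : Finset Q) (hs : s.Nonempty)
    (hE : ∀ q ∈ s, (p, q) ∈ I.E) : ∃ q ∈ s, ∀ q' ∈ s, q' ≠ q → I.firmPref p q q' :=
  exists_best_of_total _ s hs
    (fun a ha b hb c hc => I.firm_trans p a b c (hE a ha) (hE b hb) (hE c hc))
    (fun a ha b hb => I.firm_total p a b (hE a ha) (hE b hb))

theorem exists_best_firm [DecidableEq P] (q : Q) (s : Finset P) (hs : s.Nonempty)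
    (hE : ∀ p ∈ s, (p, q) ∈ I.E) : ∃ p ∈ s, ∀ p' ∈ s, p' ≠ p → I.workerPref q p p' :=
  exists_best_of_total _ s hs
    (fun a ha b hb c hc => I.worker_trans q a b c (hE a ha) (hE b hb) (hE c hc))
    (fun a ha b hb => I.worker_total q a b (hE a ha) (hE b hb))

/-- `p` is the favourite firm of `q` among her partners in `D`. -/
def IsFavourite (D : Finset (P × Q)) (p : P) (q : Q) : Prop :=
  (p, q) ∈ D ∧ ∀ p', (p', q) ∈ D → p' ≠ p → I.workerPref q p p'

theorem workerPrefers_singleton {e : P × Q} {X : Finset (P × Q)} :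
    I.WorkerPrefers e.2 {e} X ↔ ∀ p', (p', e.2) ∈ X → I.workerPref e.2 e.1 p' := by
  constructor
  · rintro ⟨p, hp, h⟩
    obtain rfl : p = e.1 := congrArg Prod.fst (Finset.mem_singleton.1 hp)
    exact h
  · exact fun h => ⟨e.1, by simp, h⟩

variable {I}

theorem IsFavourite.unique {D : Finset (P × Q)} (hD : D ⊆ I.E) {p p' : P} {q : Q}
    (h : I.IsFavourite D p q) (h' : I.IsFavourite D p' q) : p = p' := by
  by_contra hne
  exact I.worker_asymm (hD h.1) (hD h'.1) (h.2 p' h'.1 (Ne.symm hne)) (h'.2 p h.1 hne)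

theorem IsWorkerOptimalStable.unique {μ ν : Finset (P × Q)} (hμ : I.IsWorkerOptimalStable μ)
    (hν : I.IsWorkerOptimalStable ν) : μ = ν := by
  ext ⟨p, q⟩
  rcases hμ.2 ν hν.1 q with ⟨p₁, h₁, hb₁⟩ | h
  · rcases hν.2 μ hμ.1 q with ⟨p₂, h₂, hb₂⟩ | h
    · exact absurd (hb₂ p₁ h₁)
        (I.worker_asymm (hμ.1.1.1 h₁) (hν.1.1.1 h₂) (hb₁ p₂ h₂))
    · exact (h p).symm
  · exact h p

end Preferences

/-! ### Existence of the worker-optimal stable matching by deferred acceptance -/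

section WorkerOptimal

variable {P Q : Type*} [DecidableEq P] [DecidableEq Q] (I : MatchingInstance P Q)

/-- `D` contains every stable matching, and every pair outside `D` is rejected by its firm in
favour of a worker whose favourite in `D` is that firm. Such sets arise as the pairs not yet
rejected during worker-proposing deferred acceptance. -/
def IsDeferredSet (D : Finset (P × Q)) : Prop :=
  D ⊆ I.E ∧ (∀ ν, I.IsStable ν → ν ⊆ D) ∧
    ∀ p q, (p, q) ∈ I.E → (p, q) ∉ D → ∃ q', I.IsFavourite D p q' ∧ I.firmPref p q' q

variable {I}

/-- One rejection step of deferred acceptance. A stable matching containing `(p, q')` would be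
blocked by `(p, q)`, since it lies in `D` and `p` is the favourite of `q` there. -/
theorem IsDeferredSet.erase {D : Finset (P × Q)} (hD : I.IsDeferredSet D) {p : P} {q q' : Q}
    (hq : I.IsFavourite D p q) (hq' : I.IsFavourite D p q') (hr : I.firmPref p q q')
    (hne : q ≠ q') : I.IsDeferredSet (D.erase (p, q')) := by
  obtain ⟨hE, hst, hrej⟩ := hD
  have hfav : ∀ p₀ q₀, I.IsFavourite D p₀ q₀ → (p₀, q₀) ≠ (p, q') →
      I.IsFavourite (D.erase (p, q')) p₀ q₀ := fun p₀ q₀ h hn =>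
    ⟨Finset.mem_erase.2 ⟨hn, h.1⟩, fun p' hp' => h.2 p' (Finset.mem_of_mem_erase hp')⟩
  have hfq := hfav p q hq (by simp [hne])
  refine ⟨(Finset.erase_subset _ _).trans hE, fun ν hν e he => ?_, fun p₀ q₀ h₀ hn₀ => ?_⟩
  · refine Finset.mem_erase.2 ⟨?_, hst ν hν he⟩
    rintro rfl
    refine hν.2 p q ⟨hE hq.1, fun q₁ h₁ => ?_, fun p₁ h₁ => ?_⟩
    · rwa [hν.1.2.1 p q₁ q' h₁ he]
    · refine hq.2 p₁ (hst ν hν h₁) ?_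
      rintro rfl
      exact hne (hν.1.2.1 p₁ q q' h₁ he)
  · by_cases he : (p₀, q₀) = (p, q')
    · obtain ⟨rfl, rfl⟩ := Prod.mk.inj he
      exact ⟨q, hfq, hr⟩
    · obtain ⟨q₁, h₁, hr₁⟩ := hrej p₀ q₀ h₀ (fun h => hn₀ (Finset.mem_erase.2 ⟨he, h⟩))
      by_cases he₁ : (p₀, q₁) = (p, q')
      · obtain ⟨rfl, rfl⟩ := Prod.mk.inj he₁
        exact ⟨q, hfq, I.firm_trans _ _ _ _ (hE hq.1) (hE h₁.1) h₀ hr hr₁⟩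
      · exact ⟨q₁, hfav _ _ h₁ he₁, hr₁⟩

variable (I)

theorem exists_isWorkerOptimalStable : ∃ μ, I.IsWorkerOptimalStable μ := by
  classical
  obtain ⟨D, hD, hmin⟩ := (wellFounded_lt (α := Finset (P × Q))).has_min
    {D | I.IsDeferredSet D} ⟨I.E, subset_rfl, fun ν hν => hν.1.1, fun p q h h' => absurd h h'⟩
  have hD' : I.IsDeferredSet D := hD
  obtain ⟨hE, hst, hrej⟩ := hD'
  -- By minimality of `D` no further rejection is possible, so the favourite pairs form a matching.
  have huniq : ∀ p q q', I.IsFavourite D p q → I.IsFavourite D p q' → q = q' := by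
    intro p q q' h h'
    by_contra hne
    rcases I.firm_total p q q' (hE h.1) (hE h'.1) hne with hr | hr
    · exact hmin _ (hD.erase h h' hr hne) (Finset.erase_ssubset h'.1)
    · exact hmin _ (hD.erase h' h hr (Ne.symm hne)) (Finset.erase_ssubset h.1)
  have hex : ∀ p q, (p, q) ∈ D → ∃ p', I.IsFavourite D p' q := by
    intro p q h
    obtain ⟨p', hp', hb⟩ := I.exists_best_firm q ((D.filter (fun e => e.2 = q)).image Prod.fst)
      ⟨p, Finset.mem_image.2 ⟨(p, q), by simp [h], rfl⟩⟩ (fun p' hp' => by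
        obtain ⟨⟨a, b⟩, hab, rfl⟩ := Finset.mem_image.1 hp'
        obtain ⟨habD, rfl⟩ := Finset.mem_filter.1 hab
        exact hE habD)
    obtain ⟨⟨a, b⟩, hab, rfl⟩ := Finset.mem_image.1 hp'
    obtain ⟨habD, rfl⟩ := Finset.mem_filter.1 hab
    exact ⟨a, habD, fun p'' h'' hne => hb p''
      (Finset.mem_image.2 ⟨(p'', b), by simpa using h'', rfl⟩) hne⟩
  have hmem : ∀ p q, (p, q) ∈ D.filter (fun e => I.IsFavourite D e.1 e.2) ↔
      I.IsFavourite D p q := fun p q => by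
    simp only [Finset.mem_filter, and_iff_right_iff_imp]
    exact fun h => h.1
  refine ⟨D.filter (fun e => I.IsFavourite D e.1 e.2), ⟨⟨?_, ?_, ?_⟩, ?_⟩, ?_⟩
  · exact (Finset.filter_subset _ _).trans hE
  · intro p q q' h h'
    exact huniq p q q' ((hmem _ _).1 h) ((hmem _ _).1 h')
  · intro q p p' h h'
    exact IsFavourite.unique hE ((hmem _ _).1 h) ((hmem _ _).1 h')
  · rintro p q ⟨hpq, hf, hw⟩
    -- A blocking pair inside `D` contradicts the worker's favourite; one outside `D` was rejected
    -- for a worker whom the firm still holds.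
    by_cases hd : (p, q) ∈ D
    · obtain ⟨p', h'⟩ := hex p q hd
      have hr := hw p' ((hmem _ _).2 h')
      by_cases hne : p = p'
      · exact I.worker_irrefl q p hpq (by rwa [← hne] at hr)
      · exact I.worker_asymm (hE h'.1) hpq (h'.2 p hd hne) hr
    · obtain ⟨q', h', hr⟩ := hrej p q hpq hd
      exact I.firm_asymm (hE h'.1) hpq hr (hf q' ((hmem _ _).2 h'))
  · intro ν hν q
    by_cases hq : ∃ p, (p, q) ∈ D
    · obtain ⟨p, hp⟩ := hq
      obtain ⟨p', h'⟩ := hex p q hp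
      by_cases hn : (p', q) ∈ ν
      · refine Or.inr fun p₁ => ⟨fun h₁ => ?_, fun h₁ => ?_⟩
        · rwa [IsFavourite.unique hE ((hmem _ _).1 h₁) h']
        · rw [hν.1.2.2 q p₁ p' h₁ hn]
          exact (hmem _ _).2 h'
      · refine Or.inl ⟨p', (hmem _ _).2 h', fun p₁ h₁ => h'.2 p₁ (hst ν hν h₁) ?_⟩
        rintro rfl
        exact hn h₁
    · push Not at hq
      exact Or.inr fun p => iff_of_false (fun h => hq p ((hmem _ _).1 h).1)
        (fun h => hq p (hst ν hν h))

end WorkerOptimal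

/-! ### Rotations and the induced order of the firms -/

section Rotations

variable {P Q : Type*} (I : MatchingInstance P Q)

/-- `q` would leave her assignment in `μ` for the firm `p`. -/
def IsCandidate (μ : Finset (P × Q)) (p : P) (q : Q) : Prop :=
  (p, q) ∈ I.E ∧ ∀ p', (p', q) ∈ μ → I.workerPref q p p'

/-- `q` is the favourite of `p` among the workers who would leave their assignment for `p`. -/
def IsBestCandidate (μ : Finset (P × Q)) (p : P) (q : Q) : Prop :=
  I.IsCandidate μ p q ∧ ∀ q', I.IsCandidate μ p q' → q' ≠ q → I.firmPref p q q'

/-- `p'` employs in `μ` the best candidate of `p`. -/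
def IsNextFirm (μ : Finset (P × Q)) (p p' : P) : Prop :=
  ∃ q, I.IsBestCandidate μ p q ∧ (p', q) ∈ μ

variable {I}

theorem IsBestCandidate.unique {μ : Finset (P × Q)} {p : P} {q q' : Q}
    (h : I.IsBestCandidate μ p q) (h' : I.IsBestCandidate μ p q') : q = q' := by
  by_contra hne
  exact I.firm_asymm h.1.1 h'.1.1 (h.2 q' h'.1 (Ne.symm hne)) (h'.2 q h.1 hne)

theorem exists_isBestCandidate [DecidableEq Q] {μ : Finset (P × Q)} {p : P} {q : Q}
    (h : I.IsCandidate μ p q) : ∃ q', I.IsBestCandidate μ p q' := by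
  classical
  have hm : ∀ q, I.IsCandidate μ p q → q ∈ (I.E.image Prod.snd).filter (I.IsCandidate μ p) :=
    fun q h => Finset.mem_filter.2 ⟨Finset.mem_image.2 ⟨(p, q), h.1, rfl⟩, h⟩
  obtain ⟨q', h', hb⟩ := I.exists_best_worker p _ ⟨q, hm q h⟩
    (fun q hq => (Finset.mem_filter.1 hq).2.1)
  exact ⟨q', (Finset.mem_filter.1 h').2, fun q₁ h₁ => hb q₁ (hm q₁ h₁)⟩

/-- Moving every firm of a rotation to its best candidate gives a stable matching that its workers
prefer, so a worker-optimal stable matching admits no rotation. -/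
theorem IsWorkerOptimalStable.no_rotation {μ : Finset (P × Q)} (hμ : I.IsWorkerOptimalStable μ)
    (F : Finset P) (f : P → P) (hne : F.Nonempty) (hf : ∀ p ∈ F, f p ∈ F)
    (hnext : ∀ p ∈ F, I.IsNextFirm μ p (f p)) (hinj : Set.InjOn f F) : False := by
  classical
  obtain ⟨⟨⟨hE, hm₁, hm₂⟩, hblk⟩, hopt⟩ := hμ
  have hsurj : ∀ p' ∈ F, ∃ p ∈ F, f p = p' := fun p' hp' => by
    have := Finset.surj_on_of_inj_on_of_card_le (s := F) (t := F) (fun p _ => f p) hf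
      (fun a b ha hb h => hinj ha hb h) le_rfl p' hp'
    obtain ⟨p, hp, h⟩ := this
    exact ⟨p, hp, h.symm⟩
  have hbest : ∀ p q, I.IsBestCandidate μ p q → p ∈ F → (f p, q) ∈ μ := by
    intro p q h hp
    obtain ⟨q', h', hq'⟩ := hnext p hp
    rwa [h.unique h']
  set ν : Finset (P × Q) := I.E.filter
    (fun e => (e.1 ∈ F ∧ I.IsBestCandidate μ e.1 e.2) ∨ (e.1 ∉ F ∧ e ∈ μ)) with hνdef
  have hmem : ∀ p q, (p, q) ∈ ν ↔
      (p ∈ F ∧ I.IsBestCandidate μ p q) ∨ (p ∉ F ∧ (p, q) ∈ μ) := by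
    intro p q
    simp only [hνdef, Finset.mem_filter, and_iff_right_iff_imp]
    rintro (h | h)
    · exact h.2.1.1
    · exact hE h.2
  have hst : I.IsStable ν := by
    refine ⟨⟨Finset.filter_subset _ _, ?_, ?_⟩, ?_⟩
    · intro p q q' h h'
      rw [hmem] at h h'
      rcases h with ⟨hp, h⟩ | ⟨hp, h⟩ <;> rcases h' with ⟨hp', h'⟩ | ⟨hp', h'⟩
      · exact h.unique h'
      · exact absurd hp hp'
      · exact absurd hp' hp
      · exact hm₁ p q q' h h'
    · intro q p p' h h'
      rw [hmem] at h h'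
      rcases h with ⟨hp, h⟩ | ⟨hp, h⟩ <;> rcases h' with ⟨hp', h'⟩ | ⟨hp', h'⟩
      · exact hinj hp hp' (hm₂ q _ _ (hbest p q h hp) (hbest p' q h' hp'))
      · exact absurd (hm₂ q _ _ (hbest p q h hp) h' ▸ hf p hp) hp'
      · exact absurd (hm₂ q _ _ (hbest p' q h' hp') h ▸ hf p' hp') hp
      · exact hm₂ q p p' h h'
    · rintro p q ⟨hpq, hfirm, hw⟩
      -- Workers only gain in passing from `μ` to `ν`, so a worker who would leave `ν` for `p` would
      -- also leave `μ` for `p`.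
      have hc : I.IsCandidate μ p q := by
        refine ⟨hpq, fun p' hp' => ?_⟩
        by_cases hF : p' ∈ F
        · obtain ⟨p₁, hp₁, rfl⟩ := hsurj p' hF
          obtain ⟨q₁, h₁, hq₁⟩ := hnext p₁ hp₁
          obtain rfl := hm₁ _ _ _ hq₁ hp'
          exact I.worker_trans q₁ p p₁ (f p₁) hpq h₁.1.1 (hE hp')
            (hw p₁ ((hmem _ _).2 (Or.inl ⟨hp₁, h₁⟩))) (h₁.1.2 _ hp')
        · exact hw p' ((hmem _ _).2 (Or.inr ⟨hF, hp'⟩))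
      by_cases hF : p ∈ F
      · obtain ⟨q₁, h₁, -⟩ := hnext p hF
        have hr := hfirm q₁ ((hmem _ _).2 (Or.inl ⟨hF, h₁⟩))
        by_cases hqq : q = q₁
        · exact I.firm_irrefl p q hpq (by rwa [← hqq] at hr)
        · exact I.firm_asymm h₁.1.1 hpq (h₁.2 q hc hqq) hr
      · exact hblk p q ⟨hpq, fun q' hq' => hfirm q' ((hmem _ _).2 (Or.inr ⟨hF, hq'⟩)), hc.2⟩
  obtain ⟨p, hp⟩ := hne
  obtain ⟨q, hq, hqf⟩ := hnext p hp
  have hpν : (p, q) ∈ ν := (hmem _ _).2 (Or.inl ⟨hp, hq⟩)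
  rcases hopt ν hst q with ⟨p₁, h₁, hb₁⟩ | h
  · exact I.worker_asymm hq.1.1 (hE h₁) (hq.1.2 p₁ h₁) (hb₁ p hpν)
  · exact I.worker_irrefl q p hq.1.1 (hq.1.2 p ((h p).2 hpν))

/-- Otherwise the next-firm relation gives a self-map of `F`. If it is onto it is injective, hence a
rotation; if not, its image is a smaller set closed under the map, excluded by induction. -/
theorem IsWorkerOptimalStable.exists_no_next {μ : Finset (P × Q)}
    (hμ : I.IsWorkerOptimalStable μ) (F : Finset P) (hne : F.Nonempty) :
    ∃ p ∈ F, ∀ p' ∈ F, ¬ I.IsNextFirm μ p p' := by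
  classical
  induction F using Finset.strongInduction with
  | H F ih =>
    by_contra! hcon
    choose! f hf hnext using hcon
    have hsub : F.image f ⊆ F := Finset.image_subset_iff.2 hf
    rcases hsub.eq_or_ssubset with heq | hss
    · exact hμ.no_rotation F f hne hf hnext (Finset.card_image_iff.1 (by rw [heq]))
    · obtain ⟨p, hp, hno⟩ := ih _ hss (hne.image f)
      exact hno (f p) (Finset.mem_image_of_mem f (hsub hp)) (hnext p (hsub hp))

theorem IsWorkerOptimalStable.exists_firm_order [Fintype P] {μ : Finset (P × Q)}
    (hμ : I.IsWorkerOptimalStable μ) :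
    ∃ π : Fin (Fintype.card P) ≃ P, ∀ p p', I.IsNextFirm μ p p' → π.symm p < π.symm p' := by
  classical
  let r : P → P → Prop := fun p' p => I.IsNextFirm μ p p'
  have hwf : IsWellFounded P r := by
    rw [isWellFounded_iff, WellFounded.wellFounded_iff_has_min]
    intro s hs
    obtain ⟨p, hp, h⟩ := hμ.exists_no_next s.toFinset (Set.toFinset_nonempty.2 hs)
    exact ⟨p, Set.mem_toFinset.1 hp, fun p' hp' => h p' (Set.mem_toFinset.2 hp')⟩
  let e := (Fintype.equivFin P).symm
  -- The next firm has the smaller rank and must come later, so the sort is by decreasing rank.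
  let g : Fin (Fintype.card P) → Ordinalᵒᵈ := fun i => OrderDual.toDual (IsWellFounded.rank r (e i))
  refine ⟨(Tuple.sort g).trans e, fun p p' h => ?_⟩
  by_contra! hle
  have hmono := Tuple.monotone_sort g hle
  simp [g] at hmono
  exact absurd (IsWellFounded.rank_lt_of_rel (r := r) h) (not_lt.2 hmono)

end Rotations

/-! ### Backward induction: existence of equilibria and uniqueness of their outcome -/

section Equilibrium

variable {P Q : Type*} [DecidableEq P] [DecidableEq Q] (I : MatchingInstance P Q)

theorem mem_contractOffers {e f : P × Q} {σ : List (P × Q)} :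
    f ∈ contractOffers e σ ↔ f ∈ σ ∧ f.1 ≠ e.1 ∧ f.2 ≠ e.2 := by
  simp [contractOffers]

theorem contractOffers_sublist (e : P × Q) (σ : List (P × Q)) :
    (contractOffers e σ).Sublist σ := List.filter_sublist

theorem length_contractOffers_lt (e f : P × Q) (σ : List (P × Q)) :
    (contractOffers e σ).length < (f :: σ).length :=
  Nat.lt_succ_of_le (contractOffers_sublist e σ).length_le

open Classical in
/-- The outcome of the game on the offers `σ` found by backward induction. -/
noncomputable def speOut : List (P × Q) → Finset (P × Q)
  | [] => ∅
  | e :: σ =>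
    if I.WorkerPrefers e.2 {e} (speOut σ) then insert e (speOut (contractOffers e σ))
    else speOut σ
termination_by σ => σ.length
decreasing_by
  · exact Nat.lt_succ_self _
  · exact Nat.lt_succ_of_le (List.length_filter_le _ _)

variable {I}

theorem speOut_cons_of_accept {e : P × Q} {σ : List (P × Q)}
    (h : ∀ p', (p', e.2) ∈ I.speOut σ → I.workerPref e.2 e.1 p') :
    I.speOut (e :: σ) = insert e (I.speOut (contractOffers e σ)) := by
  rw [speOut, if_pos (I.workerPrefers_singleton.2 h)]

theorem speOut_cons_of_reject {e : P × Q} {σ : List (P × Q)}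
    (h : ¬ ∀ p', (p', e.2) ∈ I.speOut σ → I.workerPref e.2 e.1 p') :
    I.speOut (e :: σ) = I.speOut σ := by
  rw [speOut, if_neg (fun hc => h (I.workerPrefers_singleton.1 hc))]

/-- Induction over the subgames of a sequential matching game. -/
theorem offers_induction {motive : List (P × Q) → Prop} (nil : motive [])
    (cons : ∀ e σ, motive (contractOffers e σ) → motive σ → motive (e :: σ))
    (σ : List (P × Q)) : motive σ := by
  induction hn : σ.length using Nat.strong_induction_on generalizing σ with
  | _ n ih =>
    subst hn
    cases σ with
    | nil => exact nil
    | cons e σ =>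
      exact cons e σ (ih _ (length_contractOffers_lt e e σ) _ rfl)
        (ih _ (Nat.lt_succ_self _) _ rfl)

theorem mem_of_mem_outcome {σ : List (P × Q)} {s : StrategyProfile} {f : P × Q}
    (hf : f ∈ outcome σ s) : f ∈ σ := by
  induction σ using offers_induction generalizing s with
  | nil => simp [outcome] at hf
  | cons e σ ih₁ ih₂ =>
    rw [outcome] at hf
    split at hf
    · rcases Finset.mem_insert.1 hf with rfl | hf
      · exact List.mem_cons_self
      · exact List.mem_cons_of_mem _ (mem_contractOffers.1 (ih₁ hf)).1
    · exact List.mem_cons_of_mem _ (ih₂ hf)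

theorem mem_of_mem_speOut {σ : List (P × Q)} {f : P × Q} (hf : f ∈ I.speOut σ) : f ∈ σ := by
  induction σ using offers_induction with
  | nil => simp [speOut] at hf
  | cons e σ ih₁ ih₂ =>
    by_cases h : ∀ p', (p', e.2) ∈ I.speOut σ → I.workerPref e.2 e.1 p'
    · rw [speOut_cons_of_accept h] at hf
      rcases Finset.mem_insert.1 hf with rfl | hf
      · exact List.mem_cons_self
      · exact List.mem_cons_of_mem _ (mem_contractOffers.1 (ih₁ hf)).1
    · rw [speOut_cons_of_reject h] at hf
      exact List.mem_cons_of_mem _ (ih₂ hf)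

theorem eq_of_mem_insert {e : P × Q} {σ : List (P × Q)} {X : Finset (P × Q)}
    (hX : ∀ f ∈ X, f ∈ contractOffers e σ) {p : P} (h : (p, e.2) ∈ insert e X) : p = e.1 := by
  rcases Finset.mem_insert.1 h with h | h
  · exact congrArg Prod.fst h
  · exact absurd rfl (mem_contractOffers.1 (hX _ h)).2.2

/-- There are no ties: the offer `e` does not recur in `σ`, so a worker who does not gain by
accepting it strictly loses. This makes the equilibrium outcome unique. -/
theorem exists_better_of_reject {e : P × Q} {σ : List (P × Q)} (hnd : (e :: σ).Nodup)
    (hE : ∀ f ∈ e :: σ, f ∈ I.E)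
    (h : ¬ ∀ p', (p', e.2) ∈ I.speOut σ → I.workerPref e.2 e.1 p') :
    ∃ p', (p', e.2) ∈ I.speOut σ ∧ I.workerPref e.2 p' e.1 := by
  push Not at h
  obtain ⟨p', hp', hn⟩ := h
  refine ⟨p', hp', ?_⟩
  have hne : p' ≠ e.1 := by
    rintro rfl
    exact (List.nodup_cons.1 hnd).1 (mem_of_mem_speOut hp')
  exact (I.worker_total e.2 p' e.1 (hE _ (List.mem_cons_of_mem _ (mem_of_mem_speOut hp')))
    (hE e List.mem_cons_self) hne).resolve_right hn

/-- Every subgame perfect equilibrium has the outcome found by backward induction. -/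
theorem IsSPE.outcome_eq {σ : List (P × Q)} {s : StrategyProfile} (hnd : σ.Nodup)
    (hE : ∀ f ∈ σ, f ∈ I.E) (hs : I.IsSPE σ s) : outcome σ s = I.speOut σ := by
  induction σ using offers_induction generalizing s with
  | nil => simp [outcome, speOut]
  | cons e σ ih₁ ih₂ =>
    have hnd' := (List.nodup_cons.1 hnd).2
    have hE' : ∀ f ∈ σ, f ∈ I.E := fun f hf => hE f (List.mem_cons_of_mem _ hf)
    have hacc := ih₁ (hnd'.sublist (contractOffers_sublist e σ))
      (fun f hf => hE' f (mem_contractOffers.1 hf).1)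
      (s := fun h => s (OfferAction.accept :: h)) (fun h => hs (OfferAction.accept :: h))
    have hrej := ih₂ hnd' hE' (s := fun h => s (OfferAction.reject :: h))
      (fun h => hs (OfferAction.reject :: h))
    have hroot : I.IsNash (e :: σ) s := hs []
    -- Only deviations at the root are needed, since the induction already settles both
    -- continuations.
    have hdev : ∀ a : OfferAction, ¬ I.WorkerPrefers e.2
        (outcome (e :: σ) (fun h => if h = [] then a else s h)) (outcome (e :: σ) s) := by
      intro a
      refine hroot e.2 _ (fun h f hf hne => ?_)
      by_cases hh : h = []
      · subst hh
        simp only [offersAfter, List.head?_cons, Option.some.injEq] at hf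
        exact absurd (by rw [hf]) hne
      · simp [hh]
    cases hsn : s [] with
    | accept =>
      have hd := hdev OfferAction.reject
      simp only [outcome, hsn, if_true, List.cons_ne_nil, if_false, hacc, hrej] at hd ⊢
      rw [speOut_cons_of_accept]
      intro p' hp'
      by_contra hn
      have hb := exists_better_of_reject hnd hE (fun h => hn (h p' hp'))
      obtain ⟨p₁, h₁, hr₁⟩ := hb
      refine hd ⟨p₁, h₁, fun p₂ h₂ => ?_⟩
      rwa [eq_of_mem_insert (fun f hf => mem_of_mem_speOut hf) h₂]
    | reject =>
      have hd := hdev OfferAction.accept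
      simp only [outcome, hsn, if_true, List.cons_ne_nil, if_false, hacc, hrej] at hd ⊢
      rw [speOut_cons_of_reject]
      exact fun h => hd ⟨e.1, by simp, h⟩

variable (I)

open Classical in
/-- The strategy profile found by backward induction. -/
noncomputable def speProfile (σ : List (P × Q)) : StrategyProfile := fun h =>
  match offersAfter σ h with
  | [] => OfferAction.reject
  | e :: σ' =>
    if I.WorkerPrefers e.2 {e} (I.speOut σ') then OfferAction.accept else OfferAction.reject

theorem offersAfter_nil (h : List OfferAction) :
    offersAfter ([] : List (P × Q)) h = [] := by
  cases h <;> rfl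

theorem offersAfter_append (σ : List (P × Q)) (h h' : List OfferAction) :
    offersAfter σ (h ++ h') = offersAfter (offersAfter σ h) h' := by
  induction h generalizing σ with
  | nil => cases σ <;> rfl
  | cons a h ih =>
    cases σ with
    | nil => simp [offersAfter_nil]
    | cons e σ => cases a <;> exact ih _

theorem offersAfter_sublist (σ : List (P × Q)) (h : List OfferAction) :
    (offersAfter σ h).Sublist σ := by
  induction h generalizing σ with
  | nil => cases σ <;> exact List.Sublist.refl _
  | cons a h ih =>
    cases σ with
    | nil => simp [offersAfter_nil]
    | cons e σ =>
      cases a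
      · exact ((ih _).trans (contractOffers_sublist e σ)).trans (List.sublist_cons_self _ _)
      · exact (ih _).trans (List.sublist_cons_self _ _)

/-- The prescribed action depends only on the remaining offers, so subgame perfection reduces to the
Nash property of each such profile in its own game. -/
theorem speProfile_append (σ : List (P × Q)) (h : List OfferAction) :
    (fun h' => I.speProfile σ (h ++ h')) = I.speProfile (offersAfter σ h) := by
  funext h'
  simp only [speProfile, offersAfter_append]

theorem speProfile_cons_nil_of_accept {e : P × Q} {σ : List (P × Q)}
    (h : ∀ p', (p', e.2) ∈ I.speOut σ → I.workerPref e.2 e.1 p') :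
    I.speProfile (e :: σ) [] = OfferAction.accept := by
  simp only [speProfile, offersAfter]
  rw [if_pos (I.workerPrefers_singleton.2 h)]

theorem speProfile_cons_nil_of_reject {e : P × Q} {σ : List (P × Q)}
    (h : ¬ ∀ p', (p', e.2) ∈ I.speOut σ → I.workerPref e.2 e.1 p') :
    I.speProfile (e :: σ) [] = OfferAction.reject := by
  simp only [speProfile, offersAfter]
  rw [if_neg (fun hc => h (I.workerPrefers_singleton.1 hc))]

theorem outcome_speProfile (σ : List (P × Q)) :
    outcome σ (I.speProfile σ) = I.speOut σ := by
  induction σ using offers_induction with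
  | nil => simp [outcome, speOut]
  | cons e σ ih₁ ih₂ =>
    by_cases h : ∀ p', (p', e.2) ∈ I.speOut σ → I.workerPref e.2 e.1 p'
    · rw [outcome, I.speProfile_cons_nil_of_accept h, speOut_cons_of_accept h, ← ih₁]
      rfl
    · rw [outcome, I.speProfile_cons_nil_of_reject h, speOut_cons_of_reject h, ← ih₂]
      rfl

variable {I}

theorem workerPrefers_insert {e : P × Q} {q : Q} (hq : e.2 ≠ q) {X Y : Finset (P × Q)} :
    I.WorkerPrefers q (insert e X) (insert e Y) ↔ I.WorkerPrefers q X Y := by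
  have hm : ∀ (Z : Finset (P × Q)) p, (p, q) ∈ insert e Z ↔ (p, q) ∈ Z := fun Z p => by
    rw [Finset.mem_insert, or_iff_right]
    rintro rfl
    exact hq rfl
  simp only [WorkerPrefers, hm]

/-- No worker gains by deviating from the profile found by backward induction. -/
theorem not_workerPrefers_outcome {σ : List (P × Q)} (hnd : σ.Nodup) (hE : ∀ f ∈ σ, f ∈ I.E)
    {q : Q} {s : StrategyProfile}
    (hs : ∀ h e, (offersAfter σ h).head? = some e → e.2 ≠ q → s h = I.speProfile σ h) :
    ¬ I.WorkerPrefers q (outcome σ s) (I.speOut σ) := by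
  induction σ using offers_induction generalizing s with
  | nil =>
    rintro ⟨p, hp, -⟩
    simp [outcome] at hp
  | cons e σ ih₁ ih₂ =>
    have hnd' := (List.nodup_cons.1 hnd).2
    have hE' : ∀ f ∈ σ, f ∈ I.E := fun f hf => hE f (List.mem_cons_of_mem _ hf)
    have hacc := ih₁ (hnd'.sublist (contractOffers_sublist e σ))
      (fun f hf => hE' f (mem_contractOffers.1 hf).1)
      (s := fun h => s (OfferAction.accept :: h))
      (fun h f hf hne => hs (OfferAction.accept :: h) f hf hne)
    have hrej := ih₂ hnd' hE' (s := fun h => s (OfferAction.reject :: h))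
      (fun h f hf hne => hs (OfferAction.reject :: h) f hf hne)
    by_cases hq : e.2 = q
    · subst hq
      cases hsn : s [] with
      | accept =>
        simp only [outcome, hsn]
        rintro ⟨p, hp, hb⟩
        obtain rfl := eq_of_mem_insert (fun f hf => mem_of_mem_outcome hf) hp
        by_cases h : ∀ p', (p', e.2) ∈ I.speOut σ → I.workerPref e.2 e.1 p'
        · rw [speOut_cons_of_accept h] at hb
          exact I.worker_irrefl e.2 e.1 (hE e List.mem_cons_self)
            (hb e.1 (Finset.mem_insert_self _ _))
        · rw [speOut_cons_of_reject h] at hb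
          exact h hb
      | reject =>
        simp only [outcome, hsn]
        by_cases h : ∀ p', (p', e.2) ∈ I.speOut σ → I.workerPref e.2 e.1 p'
        · rw [speOut_cons_of_accept h]
          rintro ⟨p, hp, hb⟩
          -- A deviation better than `e.1` would also beat the continuation after rejection, since
          -- `e.1` itself does.
          refine hrej ⟨p, hp, fun p' hp' => ?_⟩
          exact I.worker_trans e.2 p e.1 p' (hE' _ (mem_of_mem_outcome hp))
            (hE e List.mem_cons_self) (hE' _ (mem_of_mem_speOut hp'))
            (hb e.1 (Finset.mem_insert_self _ _)) (h p' hp')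
        · rwa [speOut_cons_of_reject h]
    · have hsn : s [] = I.speProfile (e :: σ) [] := hs [] e rfl hq
      by_cases h : ∀ p', (p', e.2) ∈ I.speOut σ → I.workerPref e.2 e.1 p'
      · rw [I.speProfile_cons_nil_of_accept h] at hsn
        rw [speOut_cons_of_accept h]
        simp only [outcome, hsn]
        rwa [workerPrefers_insert hq]
      · rw [I.speProfile_cons_nil_of_reject h] at hsn
        rw [speOut_cons_of_reject h]
        simp only [outcome, hsn]
        exact hrej

theorem isSPE_speProfile {σ : List (P × Q)} (hnd : σ.Nodup) (hE : ∀ f ∈ σ, f ∈ I.E) :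
    I.IsSPE σ (I.speProfile σ) := by
  intro h q s' hs'
  rw [speProfile_append] at hs' ⊢
  have hsub := offersAfter_sublist σ h
  rw [outcome_speProfile]
  refine not_workerPrefers_outcome (hnd.sublist hsub) (fun f hf => hE f (hsub.subset hf)) ?_
  intro h' e he hne
  rw [hs' h' e he hne, ← speProfile_append]

theorem isSPEMatching_iff {σ : List (P × Q)} (hnd : σ.Nodup) (hE : ∀ f ∈ σ, f ∈ I.E)
    (ν : Finset (P × Q)) : I.IsSPEMatching σ ν ↔ ν = I.speOut σ := by
  constructor
  · rintro ⟨s, hs, rfl⟩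
    exact hs.outcome_eq hnd hE
  · rintro rfl
    exact ⟨_, isSPE_speProfile hnd hE, I.outcome_speProfile σ⟩

/-! ### Structure of the equilibrium outcome -/

theorem speOut_firm_unique {σ : List (P × Q)} {p : P} {q q' : Q} (h : (p, q) ∈ I.speOut σ)
    (h' : (p, q') ∈ I.speOut σ) : q = q' := by
  induction σ using offers_induction with
  | nil => simp [speOut] at h
  | cons e σ ih₁ ih₂ =>
    by_cases ha : ∀ p', (p', e.2) ∈ I.speOut σ → I.workerPref e.2 e.1 p'
    · rw [speOut_cons_of_accept ha] at h h'
      rcases Finset.mem_insert.1 h with rfl | h <;> rcases Finset.mem_insert.1 h' with h' | h'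
      · exact (congrArg Prod.snd h').symm
      · exact absurd rfl (mem_contractOffers.1 (mem_of_mem_speOut h')).2.1
      · subst h'
        exact absurd rfl (mem_contractOffers.1 (mem_of_mem_speOut h)).2.1
      · exact ih₁ h h'
    · rw [speOut_cons_of_reject ha] at h h'
      exact ih₂ h h'

theorem speOut_worker_unique {σ : List (P × Q)} {p p' : P} {q : Q} (h : (p, q) ∈ I.speOut σ)
    (h' : (p', q) ∈ I.speOut σ) : p = p' := by
  induction σ using offers_induction with
  | nil => simp [speOut] at h
  | cons e σ ih₁ ih₂ =>
    by_cases ha : ∀ p', (p', e.2) ∈ I.speOut σ → I.workerPref e.2 e.1 p'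
    · rw [speOut_cons_of_accept ha] at h h'
      rcases Finset.mem_insert.1 h with rfl | h <;> rcases Finset.mem_insert.1 h' with h' | h'
      · exact (congrArg Prod.fst h').symm
      · exact absurd rfl (mem_contractOffers.1 (mem_of_mem_speOut h')).2.2
      · subst h'
        exact absurd rfl (mem_contractOffers.1 (mem_of_mem_speOut h)).2.2
      · exact ih₁ h h'
    · rw [speOut_cons_of_reject ha] at h h'
      exact ih₂ h h'

/-- An offer that is not matched in equilibrium is either rejected for a better firm, or never made
since its firm or its worker has been matched earlier. -/
theorem speOut_cases {σ : List (P × Q)} (hnd : σ.Nodup) (hE : ∀ f ∈ σ, f ∈ I.E) {p : P} {q : Q}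
    (h : (p, q) ∈ σ) :
    (p, q) ∈ I.speOut σ ∨ (∃ p₁, (p₁, q) ∈ I.speOut σ ∧ I.workerPref q p₁ p) ∨
      (∃ q₁, (p, q₁) ∈ I.speOut σ ∧ [(p, q₁), (p, q)].Sublist σ) ∨
      ∃ p₁, (p₁, q) ∈ I.speOut σ ∧ [(p₁, q), (p, q)].Sublist σ := by
  induction σ using offers_induction with
  | nil => simp at h
  | cons e σ ih₁ ih₂ =>
    have hnd' := (List.nodup_cons.1 hnd).2
    have hE' : ∀ f ∈ σ, f ∈ I.E := fun f hf => hE f (List.mem_cons_of_mem _ hf)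
    by_cases ha : ∀ p', (p', e.2) ∈ I.speOut σ → I.workerPref e.2 e.1 p'
    · rw [speOut_cons_of_accept ha]
      have hsub := contractOffers_sublist e σ
      rcases List.mem_cons.1 h with rfl | h
      · exact Or.inl (Finset.mem_insert_self _ _)
      · by_cases h₁ : p = e.1
        · subst h₁
          exact Or.inr (Or.inr (Or.inl ⟨e.2, Finset.mem_insert_self _ _,
            (List.singleton_sublist.2 h).cons_cons e⟩))
        by_cases h₂ : q = e.2
        · subst h₂
          exact Or.inr (Or.inr (Or.inr ⟨e.1, Finset.mem_insert_self _ _,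
            (List.singleton_sublist.2 h).cons_cons e⟩))
        have hs : ∀ l : List (P × Q), l.Sublist (contractOffers e σ) → l.Sublist (e :: σ) :=
          fun l hl => (hl.trans hsub).cons e
        rcases ih₁ (hnd'.sublist hsub) (fun f hf => hE' f (hsub.subset hf))
          (mem_contractOffers.2 ⟨h, h₁, h₂⟩) with h | ⟨p₁, h, hr⟩ | ⟨q₁, h, hl⟩ | ⟨p₁, h, hl⟩
        · exact Or.inl (Finset.mem_insert_of_mem h)
        · exact Or.inr (Or.inl ⟨p₁, Finset.mem_insert_of_mem h, hr⟩)
        · exact Or.inr (Or.inr (Or.inl ⟨q₁, Finset.mem_insert_of_mem h, hs _ hl⟩))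
        · exact Or.inr (Or.inr (Or.inr ⟨p₁, Finset.mem_insert_of_mem h, hs _ hl⟩))
    · rw [speOut_cons_of_reject ha]
      rcases List.mem_cons.1 h with rfl | h
      · exact Or.inr (Or.inl (exists_better_of_reject hnd hE ha))
      · rcases ih₂ hnd' hE' h with h | h | ⟨q₁, h, hl⟩ | ⟨p₁, h, hl⟩
        · exact Or.inl h
        · exact Or.inr (Or.inl h)
        · exact Or.inr (Or.inr (Or.inl ⟨q₁, h, hl.cons e⟩))
        · exact Or.inr (Or.inr (Or.inr ⟨p₁, h, hl.cons e⟩))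

/-- A worker who receives the first offer of the firm `p` can wait for it. -/
theorem speOut_guarantee {σ : List (P × Q)} (hnd : σ.Nodup) (hE : ∀ f ∈ σ, f ∈ I.E) {p : P}
    {q : Q} (h : (p, q) ∈ σ) (hfirst : ∀ q', ¬ [(p, q'), (p, q)].Sublist σ) :
    ∃ p₁, (p₁, q) ∈ I.speOut σ ∧ (p₁ = p ∨ I.workerPref q p₁ p) := by
  induction σ using offers_induction with
  | nil => simp at h
  | cons e σ ih₁ ih₂ =>
    have hnd' := (List.nodup_cons.1 hnd).2
    have hE' : ∀ f ∈ σ, f ∈ I.E := fun f hf => hE f (List.mem_cons_of_mem _ hf)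
    have hsub := contractOffers_sublist e σ
    have hIH := fun h => ih₂ hnd' hE' h (fun q' hl => hfirst q' (hl.cons e))
    by_cases ha : ∀ p', (p', e.2) ∈ I.speOut σ → I.workerPref e.2 e.1 p'
    · rw [speOut_cons_of_accept ha]
      rcases List.mem_cons.1 h with rfl | h
      · exact ⟨p, Finset.mem_insert_self _ _, Or.inl rfl⟩
      · have h₁ : p ≠ e.1 := by
          rintro rfl
          exact hfirst e.2 ((List.singleton_sublist.2 h).cons_cons e)
        -- If `q` herself takes the earlier offer `e`, she does so because it beats the result of
        -- rejecting, which by induction is at least as good as `p`.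
        by_cases h₂ : q = e.2
        · subst h₂
          obtain ⟨p₁, hp₁, hr⟩ := hIH h
          refine ⟨e.1, Finset.mem_insert_self _ _, Or.inr ?_⟩
          rcases hr with rfl | hr
          · exact ha _ hp₁
          · exact I.worker_trans e.2 e.1 p₁ p (hE e List.mem_cons_self)
              (hE' _ (mem_of_mem_speOut hp₁)) (hE' _ h) (ha _ hp₁) hr
        · obtain ⟨p₁, hp₁, hr⟩ := ih₁ (hnd'.sublist hsub) (fun f hf => hE' f (hsub.subset hf))
            (mem_contractOffers.2 ⟨h, h₁, h₂⟩) (fun q' hl => hfirst q' ((hl.trans hsub).cons e))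
          exact ⟨p₁, Finset.mem_insert_of_mem hp₁, hr⟩
    · rw [speOut_cons_of_reject ha]
      rcases List.mem_cons.1 h with rfl | h
      · obtain ⟨p₁, hp₁, hr⟩ := exists_better_of_reject hnd hE ha
        exact ⟨p₁, hp₁, Or.inr hr⟩
      · exact hIH h

end Equilibrium

/-! ### Position-based offering orders -/

section OfferingOrder

variable {P Q : Type*} [DecidableEq P] [DecidableEq Q] (I : MatchingInstance P Q)

theorem idxOf_lt_of_key_lt {α : Type*} [BEq α] [LawfulBEq α] {k : α → ℕ} {l : List α}
    (hl : l.Pairwise (fun a b => k a ≤ k b)) {a b : α} (ha : a ∈ l) (hab : k a < k b) :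
    l.idxOf a < l.idxOf b := by
  induction l with
  | nil => simp at ha
  | cons c l ih =>
    obtain ⟨hc, hl⟩ := List.pairwise_cons.1 hl
    have hcb : c ≠ b := by
      rintro rfl
      rcases List.mem_cons.1 ha with rfl | ha
      · exact lt_irrefl _ hab
      · exact absurd (hc a ha) (not_le.2 hab)
    rw [List.idxOf_cons_ne _ hcb]
    by_cases hca : c = a
    · rw [hca, List.idxOf_cons_self]
      exact Nat.succ_pos _
    · rw [List.idxOf_cons_ne _ hca]
      exact Nat.succ_lt_succ (ih hl ((List.mem_cons.1 ha).resolve_left (Ne.symm hca)))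

/-- For every order of the firms there is an offering order that follows it. -/
theorem exists_positionBased_order [Fintype P] (π : Fin (Fintype.card P) ≃ P) :
    ∃ σ : List (P × Q), I.IsOfferingOrder σ ∧
      (∀ p p', π.symm p < π.symm p' → ∀ q q', (p, q) ∈ I.E → (p', q') ∈ I.E →
        σ.idxOf (p, q) < σ.idxOf (p', q')) ∧
      (∀ p q q', [(p, q), (p, q')].Sublist σ → I.firmPref p q q') ∧
      ∀ p p' q q', [(p, q), (p', q')].Sublist σ → π.symm p ≤ π.symm p' := by
  classical
  let c : P × Q → ℕ := fun e => (I.E.filter (fun f => f.1 = e.1 ∧ I.firmPref e.1 f.2 e.2)).card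
  have hc : ∀ e, c e ≤ I.E.card := fun e => Finset.card_filter_le _ _
  have hcpref : ∀ p q q', (p, q) ∈ I.E → (p, q') ∈ I.E → I.firmPref p q q' →
      c (p, q) < c (p, q') := by
    intro p q q' h h' hr
    refine Finset.card_lt_card ⟨fun f hf => ?_, fun hsub => ?_⟩
    · obtain ⟨a, b⟩ := f
      obtain ⟨hfE, rfl, hfr⟩ := Finset.mem_filter.1 hf
      exact Finset.mem_filter.2 ⟨hfE, rfl, I.firm_trans _ _ _ _ hfE h h' hfr hr⟩
    · have := hsub (Finset.mem_filter.2 ⟨h, rfl, hr⟩)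
      exact I.firm_irrefl p q h (Finset.mem_filter.1 this).2.2
  -- A lexicographic key: the firm's position, then the number of workers it ranks higher. That
  -- number is at most `I.E.card`, so the factor `I.E.card + 1` lets the position dominate.
  let k : P × Q → ℕ := fun e => (π.symm e.1 : ℕ) * (I.E.card + 1) + c e
  have hkpos : ∀ e f : P × Q, π.symm e.1 < π.symm f.1 → k e < k f := by
    intro e f h
    have h1 : ((π.symm e.1 : ℕ) + 1) * (I.E.card + 1) ≤ (π.symm f.1 : ℕ) * (I.E.card + 1) :=
      Nat.mul_le_mul_right _ (Nat.succ_le_of_lt h)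
    have h2 := hc e
    simp only [k]
    linarith
  have hkpref : ∀ p q q', (p, q) ∈ I.E → (p, q') ∈ I.E → I.firmPref p q q' →
      k (p, q) < k (p, q') := fun p q q' h h' hr => Nat.add_lt_add_left (hcpref p q q' h h' hr) _
  let r : P × Q → P × Q → Prop := fun a b => k a ≤ k b
  have : Std.Total r := ⟨fun a b => le_total (k a) (k b)⟩
  have : IsTrans (P × Q) r := ⟨fun a b c h h' => le_trans (α := ℕ) h h'⟩
  have hperm := List.perm_insertionSort r I.E.toList
  have hpw : (I.E.toList.insertionSort r).Pairwise (fun a b => k a ≤ k b) :=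
    List.pairwise_insertionSort r I.E.toList
  have hnd : (I.E.toList.insertionSort r).Nodup := hperm.nodup_iff.2 I.E.nodup_toList
  have hmem : ∀ e, e ∈ I.E.toList.insertionSort r ↔ e ∈ I.E := fun e => by
    rw [hperm.mem_iff, Finset.mem_toList]
  have hle : ∀ a b, [a, b].Sublist (I.E.toList.insertionSort r) → k a ≤ k b := fun a b h => by
    simpa using hpw.sublist h
  refine ⟨I.E.toList.insertionSort r, ⟨hnd, hmem, ?_⟩, ?_, ?_, ?_⟩
  · intro p q q' h h' hr
    exact idxOf_lt_of_key_lt hpw ((hmem _).2 h) (hkpref p q q' h h' hr)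
  · intro p p' hp q q' h _
    exact idxOf_lt_of_key_lt hpw ((hmem _).2 h) (hkpos (p, q) (p', q') hp)
  · intro p q q' h
    have h₁ : (p, q) ∈ I.E := (hmem _).1 (h.subset (by simp))
    have h₂ : (p, q') ∈ I.E := (hmem _).1 (h.subset (by simp))
    have hne : q ≠ q' := by
      rintro rfl
      simpa using hnd.sublist h
    refine (I.firm_total p q q' h₁ h₂ hne).resolve_right fun hr => ?_
    exact absurd (hle _ _ h) (not_le.2 (hkpref p q' q h₂ h₁ hr))
  · intro p p' q q' h
    by_contra! hlt
    exact absurd (hle _ _ h) (not_le.2 (hkpos _ _ hlt))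

end OfferingOrder

/-! ### The equilibrium outcome is the worker-optimal stable matching -/

section MainResult

variable {P Q : Type*} [DecidableEq P] [DecidableEq Q] {I : MatchingInstance P Q}

/-- If every firm matched in the worker-optimal stable matching gets its favourite worker, and every
firm makes its offers before the employer of its best candidate does, then the equilibrium outcome
is the worker-optimal stable matching. -/
theorem IsWorkerOptimalStable.speOut_eq {μ : Finset (P × Q)} (hμ : I.IsWorkerOptimalStable μ)
    (htop : ∀ p q, (p, q) ∈ μ → I.IsTopOf p q) {σ : List (P × Q)} (hnd : σ.Nodup)
    (hmem : ∀ e, e ∈ σ ↔ e ∈ I.E)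
    (hpref : ∀ p q q', [(p, q), (p, q')].Sublist σ → I.firmPref p q q')
    (hnext : ∀ p p' q, I.IsNextFirm μ p p' → ¬ [(p', q), (p, q)].Sublist σ) :
    I.speOut σ = μ := by
  classical
  have hE : ∀ f ∈ σ, f ∈ I.E := fun f => (hmem f).1
  have hνE : ∀ p q, (p, q) ∈ I.speOut σ → (p, q) ∈ I.E := fun p q h => hE _ (mem_of_mem_speOut h)
  have hstable := hμ.1
  obtain ⟨⟨hμE, hμ₁, hμ₂⟩, hblk⟩ := hstable
  have hguar : ∀ p q, (p, q) ∈ μ →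
      ∃ p₁, (p₁, q) ∈ I.speOut σ ∧ (p₁ = p ∨ I.workerPref q p₁ p) := by
    intro p q h
    refine speOut_guarantee hnd hE ((hmem _).2 (hμE h)) fun q' hl => ?_
    have hr := hpref p q' q hl
    have hq'E : (p, q') ∈ I.E := hE _ (hl.subset (by simp))
    by_cases hne : q' = q
    · exact I.firm_irrefl p q (hμE h) (by rwa [hne] at hr)
    · exact I.firm_asymm (hμE h) hq'E ((htop p q h).2 q' hq'E hne) hr
  have hcand : ∀ p q, (p, q) ∈ I.speOut σ → (p, q) ∉ μ → I.IsCandidate μ p q := by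
    intro p q h hn
    refine ⟨hνE p q h, fun p' hp' => ?_⟩
    obtain ⟨p₁, h₁, hr⟩ := hguar p' q hp'
    obtain rfl := speOut_worker_unique h h₁
    exact hr.resolve_left (fun he => hn (he ▸ hp'))
  set F : Finset P := ((I.speOut σ) \ μ).image Prod.fst with hF
  have hFmem : ∀ p, p ∈ F ↔ ∃ q, (p, q) ∈ I.speOut σ ∧ (p, q) ∉ μ := by
    intro p
    simp [hF]
  have hstep : ∀ p ∈ F, ∃ p' ∈ F, ∃ q, (p, q) ∈ μ ∧ (p', q) ∈ I.speOut σ := by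
    intro p hp
    obtain ⟨q, h, hn⟩ := (hFmem p).1 hp
    have hc := hcand p q h hn
    -- A firm unmatched in `μ` would block `μ` with its candidate `q`.
    have : ∃ q', (p, q') ∈ μ := by
      by_contra! hno
      exact hblk p q ⟨hc.1, fun q' hq' => absurd hq' (hno q'), hc.2⟩
    obtain ⟨q', hq'⟩ := this
    obtain ⟨p₁, h₁, -⟩ := hguar p q' hq'
    refine ⟨p₁, (hFmem p₁).2 ⟨q', h₁, fun hμ' => ?_⟩, q', hq', h₁⟩
    obtain rfl := hμ₂ q' _ _ hμ' hq'
    exact hn (speOut_firm_unique h h₁ ▸ hq')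
  choose! f hfF hfq using hstep
  have hinj : ∀ a b, a ∈ F → b ∈ F → f a = f b → a = b := by
    intro a b ha hb hab
    obtain ⟨q, hq, hq'⟩ := hfq a ha
    obtain ⟨q₁, hq₁, hq₁'⟩ := hfq b hb
    rw [← hab] at hq₁'
    obtain rfl := speOut_firm_unique hq' hq₁'
    exact hμ₂ q a b hq hq₁
  -- The injective self-map `f` of the finite set `F` is onto, so `p` is the equilibrium employer of
  -- the `μ`-partner of some firm in `F`; that partner must be `q`.
  have hback : ∀ p q, (p, q) ∈ I.speOut σ → (p, q) ∉ μ → ∃ p' ∈ F, (p', q) ∈ μ := by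
    intro p q h hn
    obtain ⟨p', hp', hpp⟩ := Finset.surj_on_of_inj_on_of_card_le (s := F) (t := F)
      (fun p _ => f p) hfF (fun a b ha hb hab => hinj a b ha hb hab) le_rfl p
      ((hFmem p).2 ⟨q, h, hn⟩)
    obtain ⟨q', hq', hq''⟩ := hfq p' hp'
    rw [← hpp] at hq''
    obtain rfl := speOut_firm_unique h hq''
    exact ⟨p', hp', hq'⟩
  have hFempty : F = ∅ := by
    by_contra hne
    obtain ⟨p₀, hp₀, hsink⟩ := hμ.exists_no_next F (Finset.nonempty_iff_ne_empty.2 hne)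
    obtain ⟨q₁, h₁, hn₁⟩ := (hFmem p₀).1 hp₀
    obtain ⟨q₀, hq₀⟩ := exists_isBestCandidate (hcand p₀ q₁ h₁ hn₁)
    -- If `q₀` changed partner, her `μ`-firm would be in `F` and would be the next firm of `p₀`.
    have hno : ∀ p, (p, q₀) ∈ I.speOut σ → (p, q₀) ∈ μ := by
      intro p h
      by_contra hn
      obtain ⟨p', hp', hq'⟩ := hback p q₀ h hn
      exact hsink p' hp' ⟨q₀, hq₀, hq'⟩
    have hne₀ : q₁ ≠ q₀ := by
      rintro rfl
      exact hn₁ (hno p₀ h₁)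
    have hr₀ := hq₀.2 q₁ (hcand p₀ q₁ h₁ hn₁) hne₀
    -- Each possible fate of the offer `(p₀, q₀)` fails: `p₀` holds `q₁` instead, `q₀` has no better
    -- firm, `p₀` offers to `q₁` only later, and the firm holding `q₀` is the next firm of `p₀`, so
    -- its offer does not precede this one.
    rcases speOut_cases hnd hE ((hmem _).2 hq₀.1.1) with h | ⟨p₁, h, hr⟩ | ⟨q₂, h, hl⟩ | ⟨p₁, h, hl⟩
    · exact hne₀ (speOut_firm_unique h₁ h)
    · exact I.worker_asymm hq₀.1.1 (hνE _ _ h) (hq₀.1.2 p₁ (hno p₁ h)) hr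
    · obtain rfl := speOut_firm_unique h₁ h
      exact I.firm_asymm hq₀.1.1 (hνE _ _ h) hr₀ (hpref _ _ _ hl)
    · exact hnext p₀ p₁ q₀ ⟨q₀, hq₀, hno p₁ h⟩ hl
  have hsub : ∀ p q, (p, q) ∈ I.speOut σ → (p, q) ∈ μ := by
    intro p q h
    by_contra hn
    have : p ∈ F := (hFmem p).2 ⟨q, h, hn⟩
    simp [hFempty] at this
  ext ⟨p, q⟩
  refine ⟨hsub p q, fun h => ?_⟩
  obtain ⟨p₁, h₁, -⟩ := hguar p q h
  rwa [hμ₂ q p p₁ h (hsub p₁ q h₁)]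

end MainResult

end MatchingInstance

/-- The worker-optimal stable matching exists and is unique; and if every worker matched in it is on
the top of her partner firm's list, then some position-based offering order has it as its SPE
matching (an SPE exists, and the outcome of every SPE is this matching). -/
theorem mainTheorem5 {P Q : Type*} [Fintype P] [DecidableEq P] [Fintype Q] [DecidableEq Q]
    (I : MatchingInstance P Q) :
    (∃! μ : Finset (P × Q), I.IsWorkerOptimalStable μ) ∧
    ∀ μ : Finset (P × Q), I.IsWorkerOptimalStable μ →
      (∀ p q, (p, q) ∈ μ → I.IsTopOf p q) →
      ∃ σ : List (P × Q), I.IsOfferingOrder σ ∧ I.IsPositionBased σ ∧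
        ∀ ν : Finset (P × Q), I.IsSPEMatching σ ν ↔ ν = μ := by
  refine ⟨?_, fun μ hμ htop => ?_⟩
  · obtain ⟨μ, hμ⟩ := I.exists_isWorkerOptimalStable
    exact ⟨μ, hμ, fun ν hν => hν.unique hμ⟩
  · obtain ⟨π, hπ⟩ := hμ.exists_firm_order
    obtain ⟨σ, hσ, hpos, hpref, hle⟩ := I.exists_positionBased_order π
    refine ⟨σ, hσ, ⟨π, hpos⟩, fun ν => ?_⟩
    rw [MatchingInstance.isSPEMatching_iff hσ.1 (fun f => (hσ.2.1 f).1),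
      hμ.speOut_eq htop hσ.1 hσ.2.1 hpref
        (fun p p' q hn hl => absurd (hπ p p' hn) (not_lt.2 (hle p' p q q hl)))]
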